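/- Let $N\in\mathbb N$, let $p_1,\dots,p_N\in[0,1]$ (the probabilities $p_n=p_{n,m}$ that a fragment is delivered at rate $\mathcal R_n$, for a fixed TSP class $m$), let $d,u\in[0,1]$ be the rate decrement and increment probabilities, and let $\alpha\in(0,1)$ be the packet arrival probability. Write $\bar v=1-v$, let $\mathbf e$ be an all-ones column vector, $\mathbf I$ an identity matrix, and $\boldsymbol\beta_n=[1,0,\dots,0]$ ($1\times n$). Define the following blocks. * $\mathbf D_n$ ($2\le n\le N$), of size $(n-1)\times n$: the entry $(1,1)$ is $d\,\bar p_{n-1}$, all others are $0$. * $\mathbf F_n$ ($1\le n\le N$), of size $n\times n$: the diagonal entries are $\bar p_n$, except that for $n<N$ the entry $(1,1)$ is $\bar d\,\bar p_n$; the entries $(i,i+1)$ are $p_n$; all others are $0$. * $\mathbf U_n$ ($1\le n\le N-1$), of size $(n+1)\times n$: the entry $(n+1,1)$ is $u\,p_{n+1}$, all others are $0$. * $\mathbf M_n$ ($2\le n\le N$), of size $n\times n$: the entry $(n,1)$ is $\bar u\,p_n$, all others are $0$. With $\Delta=N(N+1)/2$, let $\mathbf T_m$ ($\Delta\times\Delta$)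 be the block matrix with diagonal blocks $\mathbf F_1,\dots,\mathbf F_N$, superdiagonal blocks $\mathbf D_2,\dots,\mathbf D_N$ and zeros elsewhere; let $\mathbf S_m$ ($\Delta\times\Delta$) be the block matrix with diagonal blocks $p_1,\mathbf M_2,\dots,\mathbf M_N$, subdiagonal blocks $\mathbf U_1,\dots,\mathbf U_{N-1}$ and zeros elsewhere; let $\mathbf E_m$ ($\Delta\times N$) be obtained from $\mathbf S_m$ by replacing each block by its first column; and let $\mathbf C$ ($N\times\Delta$) be block diagonal with diagonal blocks $\boldsymbol\beta_1,\dots,\boldsymbol\beta_N$. The queue is the quasi-birth-death Markov chain with transition matrix $$\mathbf P=\begin{bmatrix}\bar\alpha\mathbf I&\alpha\mathbf C&&\\ \bar\alpha\mathbf E_m&\mathbf A_1&\mathbf A_0&\\ &\mathbf A_2&\mathbf A_1&\mathbf A_0\\ &&\ddots&\ddots&\ddots\end{bmatrix},\qquad \mathbf A_0=\alpha\mathbf T_m,\quad \mathbf A_1=\bar\alpha\mathbf T_m+\alpha\mathbf S_m,\quad \mathbf A_2=\bar\alpha\mathbf S_m .$$ Assume the stability condition: the matrix $[\mathbf S_m+\mathbf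 T_m]^T-\mathbf I+\mathbf e\mathbf e^T$ is invertible and $$\bar\alpha\,\boldsymbol\Pi_m\mathbf S_m\mathbf e>\alpha\,\boldsymbol\Pi_m\mathbf T_m\mathbf e,\qquad \boldsymbol\Pi_m=\big([\mathbf S_m+\mathbf T_m]^T-\mathbf I+\mathbf e\mathbf e^T\big)^{-1}\mathbf e \ \text{ (used as a row vector)}.$$ Then the equation $\mathbf R=\alpha\mathbf T_m+\mathbf R(\alpha\mathbf S_m+\bar\alpha\mathbf T_m)+\bar\alpha\mathbf R^2\mathbf S_m$ has an entrywise minimal nonnegative solution $\mathbf R_m$, the matrix $\mathbf I-\mathbf R_m$ is invertible, and the chain has exactly one stationary distribution $\boldsymbol\pi_m=(\boldsymbol\pi_{m,0},\boldsymbol\pi_{m,1},\dots)$ (a probability vector with $\boldsymbol\pi_m\mathbf P=\boldsymbol\pi_m$, where $\boldsymbol\pi_{m,k}$ is its part with $k$ packets in the buffer). A vector $\boldsymbol\pi_m$ is this stationary distribution if and only if all of the following hold: 1. $\boldsymbol\pi_{m,1}^T$ spans the null space of $\mathbf Q_m=\big[\bar\alpha(\mathbf E_m\mathbf C+\mathbf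 T_m+\mathbf R_m\mathbf S_m)+\alpha\mathbf S_m\big]^T-\mathbf I$; 2. $\boldsymbol\pi_{m,0}=\dfrac{\bar\alpha}{\alpha}\,\boldsymbol\pi_{m,1}\mathbf E_m$; 3. $\boldsymbol\pi_{m,k}=\boldsymbol\pi_{m,1}\mathbf R_m^{k-1}$ for all $k\ge1$; 4. $\boldsymbol\pi_{m,0}\mathbf e+\boldsymbol\pi_{m,1}(\mathbf I-\mathbf R_m)^{-1}\mathbf e=1$. -/

import Mathlib

open scoped Matrix

noncomputable section

namespace RateAdaptation

/-- The phases: a pair of a transmission rate `𝓡ₙ` (`1 ≤ n ≤ N`, stored as `n - 1`) and the fragment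
`1, …, n` of the head-of-line packet which is being transmitted (stored minus one). There are
`N (N + 1) / 2` of them, in the block order of the matrices below. -/
abbrev Phase (N : ℕ) : Type := Σ n : Fin N, Fin (n.val + 1)

/-- The index `n ∈ {1, …, N}` of the rate of a phase. -/
def rate {N : ℕ} (x : Phase N) : ℕ := x.1.val + 1

/-- The index in `{1, …, n}` of the fragment of a phase. -/
def frag {N : ℕ} (x : Phase N) : ℕ := x.2.val + 1

/-! The building blocks. Here `p n` is the success probability of one fragment at rate `𝓡ₙ`
(for the TSP class under consideration); row and column indices `i j` start from one. -/

/-- `Dₙ`, of size `(n-1) × n`, for `2 ≤ n ≤ N`: the first fragment fails at rate `𝓡ₙ₋₁` and the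
transmitter moves to rate `𝓡ₙ`. -/
def blockD (p : ℕ → ℝ) (d : ℝ) (n i j : ℕ) : ℝ :=
  if i = 1 ∧ j = 1 then d * (1 - p (n - 1)) else 0

/-- `Fₙ`, of size `n × n`, for `1 ≤ n ≤ N`: transmission of the fragments of a packet at rate `𝓡ₙ`
up to the last one. A failure of the first fragment leaves the rate unchanged with probability
`1 - d`, and with probability one at the lowest rate `𝓡_N`. -/
def blockF (N : ℕ) (p : ℕ → ℝ) (d : ℝ) (n i j : ℕ) : ℝ :=
  if i = j then (if i = 1 ∧ n < N then (1 - d) * (1 - p n) else 1 - p n)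
  else if j = i + 1 then p n
  else 0

/-- `Uₙ`, of size `(n+1) × n`, for `1 ≤ n ≤ N - 1`: the last fragment of a packet succeeds at rate
`𝓡ₙ₊₁` and the transmitter moves to rate `𝓡ₙ` for the next packet. -/
def blockU (p : ℕ → ℝ) (u : ℝ) (n i j : ℕ) : ℝ :=
  if i = n + 1 ∧ j = 1 then u * p (n + 1) else 0

/-- `Mₙ`, of size `n × n`, for `2 ≤ n ≤ N`: the last fragment of a packet succeeds at rate `𝓡ₙ` and
the transmitter keeps this rate. -/
def blockM (p : ℕ → ℝ) (u : ℝ) (n i j : ℕ) : ℝ :=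
  if i = n ∧ j = 1 then (1 - u) * p n else 0

/-- The matrix `T`: diagonal blocks `F₁, …, F_N`, upper diagonal blocks `D₂, …, D_N`. -/
def matT (N : ℕ) (p : ℕ → ℝ) (d : ℝ) : Matrix (Phase N) (Phase N) ℝ :=
  Matrix.of fun x y =>
    if rate y = rate x then blockF N p d (rate x) (frag x) (frag y)
    else if rate y = rate x + 1 then blockD p d (rate y) (frag x) (frag y)
    else 0

/-- The matrix `S`: diagonal blocks `p₁, M₂, …, M_N`, lower diagonal blocks `U₁, …, U_{N-1}`. -/
def matS (N : ℕ) (p : ℕ → ℝ) (u : ℝ) : Matrix (Phase N) (Phase N) ℝ :=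
  Matrix.of fun x y =>
    if rate y = rate x then
      (if rate x = 1 then p 1 else blockM p u (rate x) (frag x) (frag y))
    else if rate x = rate y + 1 then blockU p u (rate y) (frag x) (frag y)
    else 0

/-- The matrix `E`: as `S`, with every block replaced by its first column. The column `b`
stands for the rate `𝓡` of index `b + 1`, kept in memory while the buffer is empty. -/
def matE (N : ℕ) (p : ℕ → ℝ) (u : ℝ) : Matrix (Phase N) (Fin N) ℝ :=
  Matrix.of fun x b =>
    if b.val + 1 = rate x then
      (if rate x = 1 then p 1 else blockM p u (rate x) (frag x) 1)
    else if rate x = (b.val + 1) + 1 then blockU p u (b.val + 1) (frag x) 1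
    else 0

/-- The matrix `C`: diagonal blocks the row vectors `βₙ = [1, 0, …, 0]`. -/
def matC (N : ℕ) : Matrix (Fin N) (Phase N) ℝ :=
  Matrix.of fun a y => if rate y = a.val + 1 ∧ frag y = 1 then 1 else 0

/-- The states of the queue: `Sum.inl a` is the empty buffer with the rate of index `a + 1` in
memory, `Sum.inr (k, x)` is the buffer with `k + 1` packets and phase `x`. -/
abbrev State (N : ℕ) : Type := Fin N ⊕ (ℕ × Phase N)

/-- The QBD transition matrix, with boundary blocks `(1-α) I`, `α C`, `(1-α) E` and repeating
blocks `A₀ = α T`, `A₁ = (1-α) T + α S`, `A₂ = (1-α) S`. -/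
def transition (N : ℕ) (p : ℕ → ℝ) (α d u : ℝ) : State N → State N → ℝ
  | Sum.inl a, Sum.inl b => ((1 - α) • (1 : Matrix (Fin N) (Fin N) ℝ)) a b
  | Sum.inl a, Sum.inr (l, y) => if l = 0 then (α • matC N) a y else 0
  | Sum.inr (k, x), Sum.inl b => if k = 0 then ((1 - α) • matE N p u) x b else 0
  | Sum.inr (k, x), Sum.inr (l, y) =>
      if l = k + 1 then (α • matT N p d) x y
      else if l = k then ((1 - α) • matT N p d + α • matS N p u) x y
      else if k = l + 1 then ((1 - α) • matS N p u) x y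
      else 0

/-- `π` is a stationary distribution of the QBD: a probability vector with `π P = π`. -/
structure IsStationary (N : ℕ) (p : ℕ → ℝ) (α d u : ℝ) (π : State N → ℝ) : Prop where
  nonneg : ∀ s, 0 ≤ π s
  hasSum_one : HasSum π 1
  balance : ∀ s, HasSum (fun r => π r * transition N p α d u r s) (π s)

/-- The part `π₀` of a vector on the states: empty buffer. -/
def idle {N : ℕ} (π : State N → ℝ) : Fin N → ℝ := fun a => π (Sum.inl a)

/-- The part `πₖ₊₁` of a vector on the states: `k + 1` packets in the buffer. -/
def busy {N : ℕ} (π : State N → ℝ) (k : ℕ) : Phase N → ℝ := fun x => π (Sum.inr (k, x))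

/-- The row vector `Π = ((S + T)ᵀ - I + e eᵀ)⁻¹ e`. -/
def phaseVec (N : ℕ) (p : ℕ → ℝ) (d u : ℝ) : Phase N → ℝ :=
  ((matS N p u + matT N p d)ᵀ - 1 + Matrix.vecMulVec 1 1)⁻¹ *ᵥ 1

/-- The stability condition `(1-α) Π S e > α Π T e`. If the matrix inverted in `Π` is singular,
then `Π = 0` here and the condition fails. -/
def Stable (N : ℕ) (p : ℕ → ℝ) (α d u : ℝ) : Prop :=
  (1 - α) * (phaseVec N p d u ⬝ᵥ (matS N p u *ᵥ 1)) >
    α * (phaseVec N p d u ⬝ᵥ (matT N p d *ᵥ 1))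

/-- `R` is an entrywise nonnegative solution of
`R = α T + R (α S + (1-α) T) + (1-α) R² S`. -/
def IsNonnegSolution (N : ℕ) (p : ℕ → ℝ) (α d u : ℝ) (R : Matrix (Phase N) (Phase N) ℝ) : Prop :=
  (∀ x y, 0 ≤ R x y) ∧
    R = α • matT N p d + R * (α • matS N p u + (1 - α) • matT N p d)
      + (1 - α) • (R ^ 2 * matS N p u)

/-- `R` is the minimal nonnegative solution, i.e. entrywise below every other one. -/
def IsRateMatrix (N : ℕ) (p : ℕ → ℝ) (α d u : ℝ) (R : Matrix (Phase N) (Phase N) ℝ) : Prop :=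
  IsNonnegSolution N p α d u R ∧
    ∀ R', IsNonnegSolution N p α d u R' → ∀ x y, R x y ≤ R' x y

/-- `Q = [(1-α)(E C + T + R S) + α S]ᵀ - I`. -/
def matQ (N : ℕ) (p : ℕ → ℝ) (α d u : ℝ) (R : Matrix (Phase N) (Phase N) ℝ) :
    Matrix (Phase N) (Phase N) ℝ :=
  ((1 - α) • (matE N p u * matC N + matT N p d + R * matS N p u) + α • matS N p u)ᵀ - 1

end RateAdaptation

end

namespace QBD

open Filter Topology

variable {ι κ μ : Type*} [Fintype ι]

/-! ### Entrywise inequalities -/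

lemma mul_nonneg_entry {X : Matrix κ ι ℝ} {Y : Matrix ι μ ℝ}
    (hX : ∀ i j, 0 ≤ X i j) (hY : ∀ i j, 0 ≤ Y i j) (i : κ) (j : μ) : 0 ≤ (X * Y) i j :=
  Finset.sum_nonneg fun k _ => mul_nonneg (hX i k) (hY k j)

omit [Fintype ι] in
lemma one_nonneg_entry [DecidableEq κ] (i j : κ) : 0 ≤ (1 : Matrix κ κ ℝ) i j := by
  rw [Matrix.one_apply]; split_ifs <;> norm_num

lemma mul_le_mul_entry {X X' Y Y' : Matrix ι ι ℝ} (hXX : ∀ i j, X i j ≤ X' i j)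
    (hYY : ∀ i j, Y i j ≤ Y' i j) (hX' : ∀ i j, 0 ≤ X' i j) (hY : ∀ i j, 0 ≤ Y i j) (i j : ι) :
    (X * Y) i j ≤ (X' * Y') i j :=
  Finset.sum_le_sum fun k _ => mul_le_mul (hXX i k) (hYY k j) (hY k j) (hX' i k)

lemma pow_nonneg_entry [DecidableEq ι] {X : Matrix ι ι ℝ} (hX : ∀ i j, 0 ≤ X i j) (k : ℕ) :
    ∀ i j, 0 ≤ (X ^ k) i j := by
  induction k with
  | zero => rw [pow_zero]; exact one_nonneg_entry
  | succ k ih => rw [pow_succ]; exact mul_nonneg_entry ih hX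

lemma vecMul_nonneg_entry {v : ι → ℝ} {X : Matrix ι κ ℝ} (hv : ∀ i, 0 ≤ v i)
    (hX : ∀ i j, 0 ≤ X i j) (j : κ) : 0 ≤ (v ᵥ* X) j :=
  Finset.sum_nonneg fun i _ => mul_nonneg (hv i) (hX i j)

lemma vecMul_le_vecMul_entry {v w : ι → ℝ} {X Y : Matrix ι κ ℝ} (hvw : ∀ i, v i ≤ w i)
    (hXY : ∀ i j, X i j ≤ Y i j) (hw : ∀ i, 0 ≤ w i) (hX : ∀ i j, 0 ≤ X i j) (j : κ) :
    (v ᵥ* X) j ≤ (w ᵥ* Y) j :=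
  Finset.sum_le_sum fun i _ => mul_le_mul (hvw i) (hXY i j) (hX i j) (hw i)

lemma mulVec_nonneg_entry {v : ι → ℝ} {X : Matrix κ ι ℝ} (hX : ∀ i j, 0 ≤ X i j)
    (hv : ∀ i, 0 ≤ v i) (i : κ) : 0 ≤ (X *ᵥ v) i :=
  Finset.sum_nonneg fun j _ => mul_nonneg (hX i j) (hv j)

lemma mulVec_le_mulVec_entry {v : ι → ℝ} {X Y : Matrix κ ι ℝ} (hXY : ∀ i j, X i j ≤ Y i j)
    (hv : ∀ i, 0 ≤ v i) (i : κ) : (X *ᵥ v) i ≤ (Y *ᵥ v) i :=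
  Finset.sum_le_sum fun j _ => mul_le_mul_of_nonneg_right (hXY i j) (hv j)

/-! ### Taboo occupation measures -/

variable [DecidableEq ι]

/-- The expected number of visits to level `k`, during the first `n` steps, of the
level-homogeneous chain with blocks `A₀` (up), `A₁` (same level), `A₂` (down) started at level `0`
and killed on return to level `0`. -/
noncomputable def occupation (A₀ A₁ A₂ : Matrix ι ι ℝ) : ℕ → ℕ → Matrix ι ι ℝ
  | _, 0 => 1
  | 0, _ + 1 => 0
  | n + 1, k + 1 => occupation A₀ A₁ A₂ n k * A₀ + occupation A₀ A₁ A₂ n (k + 1) * A₁ +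
      occupation A₀ A₁ A₂ n (k + 2) * A₂

/-- Successive approximations of the minimal solution of `R = A₀ + R A₁ + R² A₂`. -/
noncomputable def rateIter (A₀ A₁ A₂ : Matrix ι ι ℝ) : ℕ → Matrix ι ι ℝ
  | 0 => 0
  | n + 1 => A₀ + rateIter A₀ A₁ A₂ n * A₁ + rateIter A₀ A₁ A₂ n ^ 2 * A₂

variable {A₀ A₁ A₂ : Matrix ι ι ℝ}

@[simp] lemma occupation_level_zero (n : ℕ) : occupation A₀ A₁ A₂ n 0 = 1 := by
  cases n <;> rfl

@[simp] lemma occupation_time_zero (k : ℕ) : occupation A₀ A₁ A₂ 0 (k + 1) = 0 := rfl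

lemma occupation_succ (n k : ℕ) : occupation A₀ A₁ A₂ (n + 1) (k + 1) =
    occupation A₀ A₁ A₂ n k * A₀ + occupation A₀ A₁ A₂ n (k + 1) * A₁ +
      occupation A₀ A₁ A₂ n (k + 2) * A₂ := rfl

lemma rateIter_succ (n : ℕ) : rateIter A₀ A₁ A₂ (n + 1) =
    A₀ + rateIter A₀ A₁ A₂ n * A₁ + rateIter A₀ A₁ A₂ n ^ 2 * A₂ := rfl

lemma occupation_eq_zero (n k : ℕ) (h : n < k) : occupation A₀ A₁ A₂ n k = 0 := by
  induction n generalizing k with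
  | zero => obtain ⟨k, rfl⟩ := Nat.exists_eq_succ_of_ne_zero h.ne'; rfl
  | succ n ih =>
    obtain ⟨k, rfl⟩ := Nat.exists_eq_succ_of_ne_zero (Nat.ne_zero_of_lt h)
    rw [Nat.succ_eq_add_one, occupation_succ, ih k (by omega), ih (k + 1) (by omega),
      ih (k + 2) (by omega)]
    simp

section Nonneg

variable (h₀ : ∀ i j, 0 ≤ A₀ i j) (h₁ : ∀ i j, 0 ≤ A₁ i j) (h₂ : ∀ i j, 0 ≤ A₂ i j)
include h₀ h₁ h₂

lemma occupation_nonneg (n k : ℕ) : ∀ i j, 0 ≤ occupation A₀ A₁ A₂ n k i j := by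
  induction n generalizing k with
  | zero => cases k with
    | zero => simpa using one_nonneg_entry
    | succ k => simp
  | succ n ih => cases k with
    | zero => simpa using one_nonneg_entry
    | succ k =>
      intro i j
      exact add_nonneg (add_nonneg (mul_nonneg_entry (ih _) h₀ i j)
        (mul_nonneg_entry (ih _) h₁ i j)) (mul_nonneg_entry (ih _) h₂ i j)

lemma occupation_le_succ (n k : ℕ) :
    ∀ i j, occupation A₀ A₁ A₂ n k i j ≤ occupation A₀ A₁ A₂ (n + 1) k i j := by
  induction n generalizing k with
  | zero => cases k with
    | zero => simp
    | succ k => simpa using occupation_nonneg h₀ h₁ h₂ 1 (k + 1)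
  | succ n ih => cases k with
    | zero => simp
    | succ k =>
      have hn := occupation_nonneg h₀ h₁ h₂ (n + 1)
      intro i j
      exact add_le_add (add_le_add
        (mul_le_mul_entry (ih _) (fun _ _ => le_rfl) (hn _) h₀ i j)
        (mul_le_mul_entry (ih _) (fun _ _ => le_rfl) (hn _) h₁ i j))
        (mul_le_mul_entry (ih _) (fun _ _ => le_rfl) (hn _) h₂ i j)

lemma occupation_mono {m n : ℕ} (h : m ≤ n) (k : ℕ) (i j : ι) :
    occupation A₀ A₁ A₂ m k i j ≤ occupation A₀ A₁ A₂ n k i j :=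
  monotone_nat_of_le_succ (f := fun n => occupation A₀ A₁ A₂ n k i j)
    (fun n => occupation_le_succ h₀ h₁ h₂ n k i j) h

lemma occupation_mul_le (m n k l : ℕ) : ∀ i j,
    (occupation A₀ A₁ A₂ m k * occupation A₀ A₁ A₂ n l) i j ≤
      occupation A₀ A₁ A₂ (m + n) (k + l) i j := by
  induction n generalizing l with
  | zero => cases l with
    | zero => simp
    | succ l => simpa using occupation_nonneg h₀ h₁ h₂ m (k + (l + 1))
  | succ n ih => cases l with
    | zero => simpa using occupation_mono h₀ h₁ h₂ (by omega) k
    | succ l =>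
      have hn := occupation_nonneg h₀ h₁ h₂ (m + n)
      intro i j
      rw [occupation_succ, mul_add, mul_add, ← mul_assoc, ← mul_assoc, ← mul_assoc]
      exact add_le_add (add_le_add
        (mul_le_mul_entry (ih _) (fun _ _ => le_rfl) (hn _) h₀ i j)
        (mul_le_mul_entry (ih _) (fun _ _ => le_rfl) (hn _) h₁ i j))
        (mul_le_mul_entry (ih _) (fun _ _ => le_rfl) (hn _) h₂ i j)

lemma rateIter_nonneg (n : ℕ) : ∀ i j, 0 ≤ rateIter A₀ A₁ A₂ n i j := by
  induction n with
  | zero => simp [rateIter]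
  | succ n ih =>
    intro i j
    exact add_nonneg (add_nonneg (h₀ i j) (mul_nonneg_entry ih h₁ i j))
      (mul_nonneg_entry (pow_nonneg_entry ih 2) h₂ i j)

omit h₀ in
lemma rate_map_mono {X Y : Matrix ι ι ℝ} (hX : ∀ i j, 0 ≤ X i j) (hXY : ∀ i j, X i j ≤ Y i j)
    (i j : ι) : (A₀ + X * A₁ + X ^ 2 * A₂) i j ≤ (A₀ + Y * A₁ + Y ^ 2 * A₂) i j := by
  have hY : ∀ i j, 0 ≤ Y i j := fun i j => (hX i j).trans (hXY i j)
  rw [sq, sq]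
  exact add_le_add (add_le_add le_rfl (mul_le_mul_entry hXY (fun _ _ => le_rfl) hY h₁ i j))
    (mul_le_mul_entry (mul_le_mul_entry hXY hXY hY hX) (fun _ _ => le_rfl)
      (mul_nonneg_entry hY hY) h₂ i j)

lemma rateIter_mono (i j : ι) : Monotone fun n => rateIter A₀ A₁ A₂ n i j := by
  refine monotone_nat_of_le_succ fun n => ?_
  induction n generalizing i j with
  | zero => simpa [rateIter] using h₀ i j
  | succ n ih => exact rate_map_mono h₁ h₂ (rateIter_nonneg h₀ h₁ h₂ n) ih i j

lemma rateIter_le_of_solution {X : Matrix ι ι ℝ} (hX : ∀ i j, 0 ≤ X i j)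
    (hsol : X = A₀ + X * A₁ + X ^ 2 * A₂) (n : ℕ) :
    ∀ i j, rateIter A₀ A₁ A₂ n i j ≤ X i j := by
  induction n with
  | zero => simpa [rateIter] using hX
  | succ n ih =>
    intro i j
    rw [hsol, rateIter_succ]
    exact rate_map_mono h₁ h₂ (rateIter_nonneg h₀ h₁ h₂ n) ih i j

lemma exists_rateIter_le_occupation (n : ℕ) :
    ∃ m, ∀ i j, rateIter A₀ A₁ A₂ n i j ≤ occupation A₀ A₁ A₂ m 1 i j := by
  induction n with
  | zero => exact ⟨0, by simp [rateIter]⟩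
  | succ n ih =>
    obtain ⟨m, hm⟩ := ih
    refine ⟨m + m + 1, fun i j => ?_⟩
    have hn := occupation_nonneg h₀ h₁ h₂ (m + m)
    refine (rate_map_mono h₁ h₂ (rateIter_nonneg h₀ h₁ h₂ n) hm i j).trans ?_
    rw [occupation_succ, occupation_level_zero, one_mul, sq]
    exact add_le_add (add_le_add le_rfl
      (mul_le_mul_entry (occupation_mono h₀ h₁ h₂ (by omega) 1) (fun _ _ => le_rfl) (hn _) h₁ i j))
      (mul_le_mul_entry (occupation_mul_le h₀ h₁ h₂ m m 1 1) (fun _ _ => le_rfl) (hn _) h₂ i j)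

lemma exists_rateIter_pow_le_occupation (n k : ℕ) :
    ∃ m, ∀ i j, (rateIter A₀ A₁ A₂ n ^ k) i j ≤ occupation A₀ A₁ A₂ m k i j := by
  induction k with
  | zero => exact ⟨0, by simp⟩
  | succ k ih =>
    obtain ⟨m, hm⟩ := ih
    obtain ⟨l, hl⟩ := exists_rateIter_le_occupation h₀ h₁ h₂ n
    refine ⟨m + l, fun i j => ?_⟩
    rw [pow_succ]
    exact (mul_le_mul_entry hm hl (occupation_nonneg h₀ h₁ h₂ m k)
      (rateIter_nonneg h₀ h₁ h₂ n) i j).trans (occupation_mul_le h₀ h₁ h₂ m l k 1 i j)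

/-- Foster's bound: the level plus `g` is a Lyapunov function with drift `-δ`, which bounds
the total taboo occupation time. -/
lemma occupation_sum_le {g : ι → ℝ} {δ : ℝ} (hg : ∀ i, 0 ≤ g i)
    (hdrift : (A₀ + A₁ + A₂) *ᵥ g - g = A₂ *ᵥ 1 - A₀ *ᵥ 1 - δ • 1)
    (hA : (A₀ + A₁ + A₂) *ᵥ 1 = 1) (n K : ℕ) (hK : n ≤ K) (i : ι) :
    δ * ∑ k ∈ Finset.range K, (occupation A₀ A₁ A₂ n (k + 1) *ᵥ 1) i ≤ (A₀ *ᵥ (1 + g)) i := by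
  set V : ℕ → ι → ℝ := fun k => (k : ℝ) • 1 + g with hV
  have hV0 : ∀ k i, 0 ≤ V k i := fun k i => by
    simp only [hV, Pi.add_apply, Pi.smul_apply, Pi.one_apply, smul_eq_mul, mul_one]
    exact add_nonneg (Nat.cast_nonneg k) (hg i)
  have hstep : ∀ k, A₀ *ᵥ V (k + 2) + A₁ *ᵥ V (k + 1) + A₂ *ᵥ V k = V (k + 1) - δ • 1 := by
    intro k
    have e1 : A₀ *ᵥ V (k + 2) + A₁ *ᵥ V (k + 1) + A₂ *ᵥ V k =
        ((k : ℝ) + 1) • ((A₀ + A₁ + A₂) *ᵥ 1) + ((A₀ + A₁ + A₂) *ᵥ g - g) + A₀ *ᵥ 1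
          - A₂ *ᵥ 1 + g := by
      simp only [hV, Matrix.mulVec_add, Matrix.add_mulVec, Matrix.mulVec_smul]
      push_cast
      module
    rw [e1, hA, hdrift]
    simp only [hV]
    push_cast
    module
  set Y := occupation A₀ A₁ A₂ with hY
  have hsum : ∑ k ∈ Finset.range K, Y (n + 1) (k + 1) *ᵥ V (k + 1) =
      ∑ k ∈ Finset.range K, Y n k *ᵥ (A₀ *ᵥ V (k + 1)) +
      ∑ k ∈ Finset.range K, Y n (k + 1) *ᵥ (A₁ *ᵥ V (k + 1)) +
      ∑ k ∈ Finset.range K, Y n (k + 2) *ᵥ (A₂ *ᵥ V (k + 1)) := by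
    rw [← Finset.sum_add_distrib, ← Finset.sum_add_distrib]
    refine Finset.sum_congr rfl fun k _ => ?_
    rw [hY, occupation_succ]
    simp only [Matrix.add_mulVec, Matrix.mulVec_mulVec]
  have hYK : ∀ k, K < k → Y n k = 0 := fun k hk => occupation_eq_zero n k (by omega)
  have hup : (∑ k ∈ Finset.range K, Y n k *ᵥ (A₀ *ᵥ V (k + 1))) i ≤
      (A₀ *ᵥ V 1) i + (∑ k ∈ Finset.range K, Y n (k + 1) *ᵥ (A₀ *ᵥ V (k + 2))) i := by
    have hs := Finset.sum_range_succ' (fun k => Y n k *ᵥ (A₀ *ᵥ V (k + 1))) K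
    rw [Finset.sum_range_succ] at hs
    have hs' := congrFun hs i
    have hpos : 0 ≤ (Y n K *ᵥ (A₀ *ᵥ V (K + 1))) i :=
      mulVec_nonneg_entry (occupation_nonneg h₀ h₁ h₂ n K) (mulVec_nonneg_entry h₀ (hV0 _)) i
    simp only [Pi.add_apply, hY, occupation_level_zero, Matrix.one_mulVec, zero_add] at hs' hpos ⊢
    linarith
  have hdown : (∑ k ∈ Finset.range K, Y n (k + 2) *ᵥ (A₂ *ᵥ V (k + 1))) i ≤
      (∑ k ∈ Finset.range K, Y n (k + 1) *ᵥ (A₂ *ᵥ V k)) i := by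
    have hs := Finset.sum_range_succ' (fun k => Y n (k + 1) *ᵥ (A₂ *ᵥ V k)) K
    rw [Finset.sum_range_succ, hYK (K + 1) (by omega), Matrix.zero_mulVec, add_zero] at hs
    have hs' := congrFun hs i
    have hpos : 0 ≤ (Y n 1 *ᵥ (A₂ *ᵥ V 0)) i :=
      mulVec_nonneg_entry (occupation_nonneg h₀ h₁ h₂ n 1) (mulVec_nonneg_entry h₂ (hV0 _)) i
    simp only [Pi.add_apply, zero_add] at hs'
    linarith
  have hmono : (∑ k ∈ Finset.range K, Y n (k + 1) *ᵥ V (k + 1)) i ≤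
      (∑ k ∈ Finset.range K, Y (n + 1) (k + 1) *ᵥ V (k + 1)) i := by
    simp only [Finset.sum_apply]
    exact Finset.sum_le_sum fun k _ =>
      mulVec_le_mulVec_entry (occupation_le_succ h₀ h₁ h₂ n (k + 1)) (hV0 _) i
  have hdr : ∑ k ∈ Finset.range K, Y n (k + 1) *ᵥ (A₀ *ᵥ V (k + 2)) +
      ∑ k ∈ Finset.range K, Y n (k + 1) *ᵥ (A₁ *ᵥ V (k + 1)) +
      ∑ k ∈ Finset.range K, Y n (k + 1) *ᵥ (A₂ *ᵥ V k) =
      ∑ k ∈ Finset.range K, Y n (k + 1) *ᵥ V (k + 1) -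
        δ • ∑ k ∈ Finset.range K, Y n (k + 1) *ᵥ 1 := by
    rw [← Finset.sum_add_distrib, ← Finset.sum_add_distrib, Finset.smul_sum,
      ← Finset.sum_sub_distrib]
    refine Finset.sum_congr rfl fun k _ => ?_
    rw [← Matrix.mulVec_add, ← Matrix.mulVec_add, hstep, Matrix.mulVec_sub, Matrix.mulVec_smul]
  have hsum' := congrFun hsum i
  have hdr' := congrFun hdr i
  have hV1 : V 1 = 1 + g := by simp [hV]
  rw [hV1] at hup
  simp only [Pi.add_apply, Pi.sub_apply, Pi.smul_apply, smul_eq_mul] at hsum' hdr'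
  rw [← Finset.sum_apply]
  linarith

end Nonneg

end QBD

namespace QBD

open Filter Topology

variable {ι κ μ : Type*} [Fintype ι] [DecidableEq ι] {A₀ A₁ A₂ : Matrix ι ι ℝ}

/-! ### The rate matrix -/

section Nonneg

variable (h₀ : ∀ i j, 0 ≤ A₀ i j) (h₁ : ∀ i j, 0 ≤ A₁ i j) (h₂ : ∀ i j, 0 ≤ A₂ i j)
include h₀ h₁ h₂

lemma rateIter_pow_sum_le {g : ι → ℝ} {δ : ℝ} (hδ : 0 < δ) (hg : ∀ i, 0 ≤ g i)
    (hdrift : (A₀ + A₁ + A₂) *ᵥ g - g = A₂ *ᵥ 1 - A₀ *ᵥ 1 - δ • 1)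
    (hA : (A₀ + A₁ + A₂) *ᵥ 1 = 1) (n K : ℕ) (i j : ι) :
    ∑ k ∈ Finset.range K, (rateIter A₀ A₁ A₂ n ^ (k + 1)) i j ≤ (A₀ *ᵥ (1 + g)) i / δ := by
  choose m hm using fun k => exists_rateIter_pow_le_occupation h₀ h₁ h₂ n (k + 1)
  set M := K + ∑ k ∈ Finset.range K, m k with hM
  have hb := occupation_sum_le h₀ h₁ h₂ hg hdrift hA M M le_rfl i
  have hocc := occupation_nonneg h₀ h₁ h₂ M
  rw [le_div_iff₀' hδ]
  refine le_trans (mul_le_mul_of_nonneg_left ?_ hδ.le) hb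
  calc ∑ k ∈ Finset.range K, (rateIter A₀ A₁ A₂ n ^ (k + 1)) i j
      ≤ ∑ k ∈ Finset.range K, (occupation A₀ A₁ A₂ M (k + 1) *ᵥ 1) i := by
        refine Finset.sum_le_sum fun k hk => ((hm k i j).trans
          (occupation_mono h₀ h₁ h₂ (n := M) ?_ (k + 1) i j)).trans ?_
        · exact (Finset.single_le_sum (fun _ _ => Nat.zero_le _) hk).trans (Nat.le_add_left _ _)
        · simp only [Matrix.mulVec, dotProduct, Pi.one_apply, mul_one]
          exact Finset.single_le_sum (f := fun j => occupation A₀ A₁ A₂ M (k + 1) i j)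
            (fun j _ => hocc (k + 1) i j) (Finset.mem_univ j)
    _ ≤ ∑ k ∈ Finset.range M, (occupation A₀ A₁ A₂ M (k + 1) *ᵥ 1) i :=
        Finset.sum_le_sum_of_subset_of_nonneg
          (Finset.range_subset_range.2 (Nat.le_add_right _ _))
          fun k _ _ => mulVec_nonneg_entry (hocc (k + 1)) (fun _ => zero_le_one) i

/-- Under negative drift, `R = A₀ + R A₁ + R² A₂` has a minimal nonnegative solution, the limit of
the successive approximations, and its powers are summable. -/
theorem exists_rate_matrix {g : ι → ℝ} {δ : ℝ} (hδ : 0 < δ) (hg : ∀ i, 0 ≤ g i)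
    (hdrift : (A₀ + A₁ + A₂) *ᵥ g - g = A₂ *ᵥ 1 - A₀ *ᵥ 1 - δ • 1)
    (hA : (A₀ + A₁ + A₂) *ᵥ 1 = 1) :
    ∃ R : Matrix ι ι ℝ, Tendsto (rateIter A₀ A₁ A₂) atTop (𝓝 R) ∧ (∀ i j, 0 ≤ R i j) ∧
      R = A₀ + R * A₁ + R ^ 2 * A₂ ∧
      (∀ X : Matrix ι ι ℝ, (∀ i j, 0 ≤ X i j) → X = A₀ + X * A₁ + X ^ 2 * A₂ →
        ∀ i j, R i j ≤ X i j) ∧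
      IsUnit (1 - R) ∧ HasSum (fun k : ℕ => R ^ k) (1 - R)⁻¹ := by
  have hbdd := rateIter_pow_sum_le h₀ h₁ h₂ hδ hg hdrift hA
  have hnn := rateIter_nonneg h₀ h₁ h₂
  have hex : ∀ i j, ∃ r, Tendsto (fun n => rateIter A₀ A₁ A₂ n i j) atTop (𝓝 r) := by
    intro i j
    refine ⟨_, tendsto_atTop_ciSup (rateIter_mono h₀ h₁ h₂ i j)
      ⟨(A₀ *ᵥ (1 + g)) i / δ, ?_⟩⟩
    rintro _ ⟨n, rfl⟩
    simpa using hbdd n 1 i j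
  choose R hR using hex
  have hlim : Tendsto (rateIter A₀ A₁ A₂) atTop (𝓝 (Matrix.of R)) :=
    tendsto_pi_nhds.2 fun i => tendsto_pi_nhds.2 fun j => hR i j
  have hRnn : ∀ i j, 0 ≤ Matrix.of R i j := fun i j =>
    ge_of_tendsto' (hR i j) fun n => hnn n i j
  have hsum : Summable (fun k : ℕ => Matrix.of R ^ k) := by
    refine Pi.summable.2 fun i => Pi.summable.2 fun j => ?_
    rw [← summable_nat_add_iff 1]
    refine summable_of_sum_range_le (c := (A₀ *ᵥ (1 + g)) i / δ)
      (fun k => pow_nonneg_entry hRnn (k + 1) i j) fun K => ?_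
    refine le_of_tendsto' (x := atTop) (f := fun n =>
      ∑ k ∈ Finset.range K, (rateIter A₀ A₁ A₂ n ^ (k + 1)) i j)
      (tendsto_finsetSum _ fun k _ => ?_) fun n => hbdd n K i j
    exact tendsto_pi_nhds.1 (tendsto_pi_nhds.1 (hlim.pow (k + 1)) i) j
  have hinv : (1 - Matrix.of R) * ∑' k : ℕ, Matrix.of R ^ k = 1 := hsum.one_sub_mul_tsum_pow
  refine ⟨Matrix.of R, hlim, hRnn, ?_, ?_, ?_, ?_⟩
  · refine tendsto_nhds_unique ((tendsto_add_atTop_iff_nat 1).2 hlim) ?_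
    exact (tendsto_const_nhds.add (hlim.mul_const A₁)).add ((hlim.pow 2).mul_const A₂)
  · intro X hX hsol i j
    exact le_of_tendsto' (hR i j) fun n => rateIter_le_of_solution h₀ h₁ h₂ hX hsol n i j
  · exact IsUnit.of_mul_eq_one _ hinv
  · rw [Matrix.inv_eq_right_inv hinv]
    exact hsum.hasSum

omit [DecidableEq ι] h₀ h₁ h₂ in
lemma hasSum_vecMul {v : ℕ → ι → ℝ} {w : ι → ℝ} (h : HasSum v w) (X : Matrix ι κ ℝ) :
    HasSum (fun k => v k ᵥ* X) (w ᵥ* X) := by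
  refine Pi.hasSum.2 fun j => ?_
  exact hasSum_sum fun i _ => (Pi.hasSum.1 h i).mul_right (X i j)

omit [DecidableEq ι] h₀ h₁ h₂ in
lemma hasSum_dotProduct {v : ℕ → ι → ℝ} {w : ι → ℝ} (h : HasSum v w) (f : ι → ℝ) :
    HasSum (fun k => v k ⬝ᵥ f) (w ⬝ᵥ f) :=
  hasSum_sum fun i _ => (Pi.hasSum.1 h i).mul_right (f i)

omit [DecidableEq ι] h₀ h₁ in
/-- Under negative drift, a summable nonnegative measure which vanishes at level `0` and is
invariant at all the other levels is zero. -/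
lemma eq_zero_of_invariant {g : ι → ℝ} {δ : ℝ} (hδ : 0 < δ)
    (hdrift : (A₀ + A₁ + A₂) *ᵥ g - g = A₂ *ᵥ 1 - A₀ *ᵥ 1 - δ • 1)
    (hA : (A₀ + A₁ + A₂) *ᵥ 1 = 1) {ε : ℕ → ι → ℝ} (hε : ∀ k i, 0 ≤ ε k i)
    (hs : Summable ε) (hzero : ε 0 = 0)
    (hinv : ∀ k, ε (k + 1) = ε k ᵥ* A₀ + ε (k + 1) ᵥ* A₁ + ε (k + 2) ᵥ* A₂) (k : ℕ) :
    ε k = 0 := by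
  obtain ⟨η, hη⟩ := hs
  have hη1 : HasSum (fun k => ε (k + 1)) η := by
    rw [hasSum_nat_add_iff (f := ε) 1]; simpa [hzero] using hη
  have hη2 : HasSum (fun k => ε (k + 2)) (η - ε 1) := by
    rw [hasSum_nat_add_iff (f := ε) 2]; simpa [hzero, Finset.sum_range_succ] using hη
  have hcut : ∀ k, ε k ⬝ᵥ (A₀ *ᵥ 1) - ε (k + 1) ⬝ᵥ (A₂ *ᵥ 1) = -(ε 1 ⬝ᵥ (A₂ *ᵥ 1)) := by
    intro k
    induction k with
    | zero => simp [hzero]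
    | succ k ih =>
      have h1 : ε (k + 1) ⬝ᵥ 1 = ε (k + 1) ⬝ᵥ ((A₀ + A₁ + A₂) *ᵥ 1) := by rw [hA]
      have h2 : ε (k + 1) ⬝ᵥ 1 = ε k ⬝ᵥ (A₀ *ᵥ 1) + ε (k + 1) ⬝ᵥ (A₁ *ᵥ 1) +
          ε (k + 2) ⬝ᵥ (A₂ *ᵥ 1) := by
        conv_lhs => rw [hinv k]
        simp only [add_dotProduct, Matrix.dotProduct_mulVec]
      simp only [Matrix.add_mulVec, dotProduct_add] at h1
      linarith
  have hflux : HasSum (fun k => ε k ⬝ᵥ (A₀ *ᵥ 1) - ε (k + 1) ⬝ᵥ (A₂ *ᵥ 1))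
      (η ⬝ᵥ (A₀ *ᵥ 1) - η ⬝ᵥ (A₂ *ᵥ 1)) :=
    (hasSum_dotProduct hη _).sub (hasSum_dotProduct hη1 _)
  simp only [hcut] at hflux
  have hc : -(ε 1 ⬝ᵥ (A₂ *ᵥ 1)) = 0 := by
    exact tendsto_nhds_unique tendsto_const_nhds hflux.summable.tendsto_atTop_zero
  rw [hc] at hflux
  have hbal : η ⬝ᵥ (A₀ *ᵥ 1) - η ⬝ᵥ (A₂ *ᵥ 1) = 0 := hflux.unique hasSum_zero
  have hdown : ε 1 ᵥ* A₂ = 0 := by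
    have hz : (ε 1 ᵥ* A₂) ⬝ᵥ 1 = 0 := by rw [← Matrix.dotProduct_mulVec]; linarith
    have hn : ∀ j, 0 ≤ (ε 1 ᵥ* A₂) j := vecMul_nonneg_entry (hε 1) h₂
    rw [dotProduct_one] at hz
    ext j
    exact (Finset.sum_eq_zero_iff_of_nonneg fun j _ => hn j).1 hz j (Finset.mem_univ j)
  have hηA : η = η ᵥ* (A₀ + A₁ + A₂) := by
    have hR := ((hasSum_vecMul hη A₀).add (hasSum_vecMul hη1 A₁)).add (hasSum_vecMul hη2 A₂)
    simp only [← hinv] at hR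
    have hu := hη1.unique hR
    rwa [Matrix.sub_vecMul, hdown, sub_zero, ← Matrix.vecMul_add, ← Matrix.vecMul_add] at hu
  have hmass : δ * (η ⬝ᵥ 1) = 0 := by
    have h := congrArg (η ⬝ᵥ ·) hdrift
    simp only [dotProduct_sub, dotProduct_smul, smul_eq_mul] at h
    rw [Matrix.dotProduct_mulVec, ← hηA] at h
    linarith
  have hη0 : η ⬝ᵥ 1 = 0 := (mul_eq_zero.1 hmass).resolve_left hδ.ne'
  have hk : HasSum (fun k => ε k ⬝ᵥ 1) 0 := hη0 ▸ hasSum_dotProduct hη 1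
  simp only [dotProduct_one] at hk
  have h := (hasSum_zero_iff_of_nonneg fun k => Finset.sum_nonneg fun i _ => hε k i).1 hk
  ext i
  exact (Finset.sum_eq_zero_iff_of_nonneg fun i _ => hε k i).1 (congrFun h k) i (Finset.mem_univ i)

/-- A summable nonnegative measure, invariant at all levels but the lowest, is matrix-geometric. -/
theorem eq_vecMul_rate_pow {g : ι → ℝ} {δ : ℝ} (hδ : 0 < δ)
    (hdrift : (A₀ + A₁ + A₂) *ᵥ g - g = A₂ *ᵥ 1 - A₀ *ᵥ 1 - δ • 1)
    (hA : (A₀ + A₁ + A₂) *ᵥ 1 = 1) {R : Matrix ι ι ℝ}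
    (hlim : Tendsto (rateIter A₀ A₁ A₂) atTop (𝓝 R))
    (hR : R = A₀ + R * A₁ + R ^ 2 * A₂) (hRs : Summable (fun k : ℕ => R ^ k))
    {b : ℕ → ι → ℝ} (hb : ∀ k i, 0 ≤ b k i) (hs : Summable b)
    (hinv : ∀ k, b (k + 1) = b k ᵥ* A₀ + b (k + 1) ᵥ* A₁ + b (k + 2) ᵥ* A₂) (k : ℕ) :
    b k = b 0 ᵥ* R ^ k := by
  have hocc : ∀ n k i, (b 0 ᵥ* occupation A₀ A₁ A₂ n k) i ≤ b k i := by
    intro n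
    induction n with
    | zero =>
      rintro (_ | k) i
      · simp
      · simpa using hb (k + 1) i
    | succ n ih =>
      rintro (_ | k) i
      · simp
      · rw [occupation_succ, hinv k, Matrix.vecMul_add, Matrix.vecMul_add, ← Matrix.vecMul_vecMul,
          ← Matrix.vecMul_vecMul, ← Matrix.vecMul_vecMul]
        exact add_le_add (add_le_add
          (vecMul_le_vecMul_entry (ih _) (fun _ _ => le_rfl) (hb _) h₀ i)
          (vecMul_le_vecMul_entry (ih _) (fun _ _ => le_rfl) (hb _) h₁ i))
          (vecMul_le_vecMul_entry (ih _) (fun _ _ => le_rfl) (hb _) h₂ i)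
  have hle : ∀ k i, (b 0 ᵥ* R ^ k) i ≤ b k i := by
    intro k i
    have hl : Tendsto (fun n => (b 0 ᵥ* rateIter A₀ A₁ A₂ n ^ k) i) atTop
        (𝓝 ((b 0 ᵥ* R ^ k) i)) :=
      tendsto_finsetSum _ fun j _ => Tendsto.const_mul _
        (tendsto_pi_nhds.1 (tendsto_pi_nhds.1 (hlim.pow k) j) i)
    refine le_of_tendsto' hl fun n => ?_
    obtain ⟨m, hm⟩ := exists_rateIter_pow_le_occupation h₀ h₁ h₂ n k
    exact (vecMul_le_vecMul_entry (fun _ => le_rfl) hm (hb 0)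
      (pow_nonneg_entry (rateIter_nonneg h₀ h₁ h₂ n) k) i).trans (hocc m k i)
  have hRb : Summable fun k : ℕ => b 0 ᵥ* R ^ k :=
    Pi.summable.2 fun i => summable_sum fun j _ =>
      (Pi.summable.1 (Pi.summable.1 hRs j) i).mul_left (b 0 j)
  refine sub_eq_zero.1 (eq_zero_of_invariant h₂ hδ hdrift hA (ε := fun k => b k - b 0 ᵥ* R ^ k)
    (fun k i => sub_nonneg.2 (hle k i)) (hs.sub hRb) (by simp) (fun k => ?_) k)
  have hpow : R ^ (k + 1) = R ^ k * A₀ + R ^ (k + 1) * A₁ + R ^ (k + 2) * A₂ := by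
    have h := congrArg (R ^ k * ·) hR
    simp only [mul_add, ← mul_assoc] at h
    rwa [← pow_succ, ← pow_add] at h
  have hbR : b 0 ᵥ* R ^ (k + 1) = (b 0 ᵥ* R ^ k) ᵥ* A₀ + (b 0 ᵥ* R ^ (k + 1)) ᵥ* A₁ +
      (b 0 ᵥ* R ^ (k + 2)) ᵥ* A₂ := by
    conv_lhs => rw [hpow]
    simp only [Matrix.vecMul_add, Matrix.vecMul_vecMul]
  simp only [Matrix.sub_vecMul]
  conv_lhs => rw [hinv k, hbR]
  abel

end Nonneg

end QBD

namespace QBD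

open Filter Topology

/-! ### Stochastic matrices with a unique stationary vector -/

section Stochastic

variable {ι : Type*} [Fintype ι]

lemma abs_vecMul_eq {X : Matrix ι ι ℝ} (hX : ∀ i j, 0 ≤ X i j) (hX1 : X *ᵥ 1 = 1) {v : ι → ℝ}
    (hv : v ᵥ* X = v) : |v| ᵥ* X = |v| := by
  have hle : ∀ j, 0 ≤ (|v| ᵥ* X - |v|) j := by
    intro j
    rw [Pi.sub_apply, sub_nonneg]
    calc |v| j = |(v ᵥ* X) j| := by rw [hv]; rfl
      _ ≤ ∑ i, |v i * X i j| := Finset.abs_sum_le_sum_abs _ _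
      _ = (|v| ᵥ* X) j := Finset.sum_congr rfl fun i _ => by
          rw [abs_mul, abs_of_nonneg (hX i j), Pi.abs_apply]
  have hsum : (|v| ᵥ* X - |v|) ⬝ᵥ 1 = 0 := by
    rw [sub_dotProduct, ← Matrix.dotProduct_mulVec, hX1, sub_self]
  rw [dotProduct_one] at hsum
  ext j
  exact sub_eq_zero.1 ((Finset.sum_eq_zero_iff_of_nonneg fun j _ => hle j).1 hsum j
    (Finset.mem_univ j))

variable [DecidableEq ι] {A : Matrix ι ι ℝ} (hA : A *ᵥ 1 = 1)
  (hM : IsUnit (Aᵀ - 1 + Matrix.vecMulVec 1 1))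

lemma sub_one_add_mulVec (v : ι → ℝ) :
    (Aᵀ - 1 + Matrix.vecMulVec 1 1) *ᵥ v = v ᵥ* A - v + (v ⬝ᵥ 1) • 1 := by
  rw [Matrix.add_mulVec, Matrix.sub_mulVec, Matrix.mulVec_transpose, Matrix.one_mulVec]
  congr 1
  ext i
  simp [Matrix.mulVec, Matrix.vecMulVec_apply, dotProduct]

include hA hM

lemma stationary_sum_eq_one [Nonempty ι] :
    ((Aᵀ - 1 + Matrix.vecMulVec 1 1)⁻¹ *ᵥ 1) ⬝ᵥ 1 = 1 := by
  set ϖ := (Aᵀ - 1 + Matrix.vecMulVec 1 1)⁻¹ *ᵥ 1 with hϖ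
  have h1 : (Aᵀ - 1 + Matrix.vecMulVec 1 1) *ᵥ ϖ = 1 := by
    rw [hϖ, Matrix.mulVec_mulVec, Matrix.mul_nonsing_inv _ ((Matrix.isUnit_iff_isUnit_det _).1 hM),
      Matrix.one_mulVec]
  have h2 := congrArg (· ⬝ᵥ (1 : ι → ℝ)) h1
  simp only [sub_one_add_mulVec, add_dotProduct, sub_dotProduct, smul_dotProduct,
    ← Matrix.dotProduct_mulVec, hA, sub_self, zero_add, smul_eq_mul] at h2
  have hc : (1 : ι → ℝ) ⬝ᵥ 1 ≠ 0 := by simp [dotProduct]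
  exact mul_right_cancel₀ hc (by rw [h2, one_mul])

lemma stationary_vecMul [Nonempty ι] :
    ((Aᵀ - 1 + Matrix.vecMulVec 1 1)⁻¹ *ᵥ 1) ᵥ* A = (Aᵀ - 1 + Matrix.vecMulVec 1 1)⁻¹ *ᵥ 1 := by
  have hs := stationary_sum_eq_one hA hM
  set ϖ := (Aᵀ - 1 + Matrix.vecMulVec 1 1)⁻¹ *ᵥ 1 with hϖ
  have h1 : (Aᵀ - 1 + Matrix.vecMulVec 1 1) *ᵥ ϖ = 1 := by
    rw [hϖ, Matrix.mulVec_mulVec, Matrix.mul_nonsing_inv _ ((Matrix.isUnit_iff_isUnit_det _).1 hM),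
      Matrix.one_mulVec]
  rw [sub_one_add_mulVec, hs, one_smul, add_eq_right] at h1
  exact sub_eq_zero.1 h1

lemma eq_smul_stationary [Nonempty ι] {η : ι → ℝ} (hη : η ᵥ* A = η) :
    η = (η ⬝ᵥ 1) • ((Aᵀ - 1 + Matrix.vecMulVec 1 1)⁻¹ *ᵥ 1) := by
  refine Matrix.mulVec_injective_of_isUnit hM ?_
  rw [Matrix.mulVec_smul, sub_one_add_mulVec, sub_one_add_mulVec, hη,
    stationary_vecMul hA hM, stationary_sum_eq_one hA hM]
  simp

/-- Poisson's equation: `(A - 1) g` can be any vector, up to its stationary mean. -/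
lemma exists_poisson [Nonempty ι] (b : ι → ℝ) :
    ∃ g : ι → ℝ, (∀ i, 0 ≤ g i) ∧
      A *ᵥ g - g = b - (((Aᵀ - 1 + Matrix.vecMulVec 1 1)⁻¹ *ᵥ 1) ⬝ᵥ b) • 1 := by
  set ϖ := (Aᵀ - 1 + Matrix.vecMulVec 1 1)⁻¹ *ᵥ 1 with hϖ
  have hdet : IsUnit (Aᵀ - 1 + Matrix.vecMulVec 1 1)ᵀ.det := by
    rw [Matrix.det_transpose]; exact (Matrix.isUnit_iff_isUnit_det _).1 hM
  set g := (Aᵀ - 1 + Matrix.vecMulVec 1 1)ᵀ⁻¹ *ᵥ b with hg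
  have h1 : A *ᵥ g - g + (g ⬝ᵥ 1) • 1 = b := by
    have h : (Aᵀ - 1 + Matrix.vecMulVec 1 1)ᵀ *ᵥ g = b := by
      rw [hg, Matrix.mulVec_mulVec, Matrix.mul_nonsing_inv _ hdet, Matrix.one_mulVec]
    rw [Matrix.mulVec_transpose] at h
    rw [← h, Matrix.vecMul_add, Matrix.vecMul_sub, Matrix.vecMul_transpose, Matrix.vecMul_one]
    congr 1
    ext i
    simp [Matrix.vecMul, Matrix.vecMulVec_apply, dotProduct]
  have h2 : g ⬝ᵥ 1 = ϖ ⬝ᵥ b := by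
    have hst : ϖ ᵥ* A = ϖ := stationary_vecMul hA hM
    have hs : ϖ ⬝ᵥ 1 = 1 := stationary_sum_eq_one hA hM
    rw [← h1, dotProduct_add, dotProduct_sub, Matrix.dotProduct_mulVec, dotProduct_smul, hst, hs,
      sub_self, zero_add, smul_eq_mul, mul_one]
  refine ⟨g + (∑ i, |g i|) • 1, fun i => ?_, ?_⟩
  · have h := Finset.single_le_sum (f := fun i => |g i|) (fun i _ => abs_nonneg _)
      (Finset.mem_univ i)
    have h' := neg_abs_le (g i)
    simp only [Pi.add_apply, Pi.smul_apply, Pi.one_apply, smul_eq_mul, mul_one]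
    linarith
  · rw [Matrix.mulVec_add, Matrix.mulVec_smul, hA, ← h2, ← h1]
    abel

end Stochastic

/-! ### Queues with Bernoulli arrivals and service phases `S` (completion), `T` (continuation) -/

section Queue

variable {ι : Type*} [Fintype ι] [DecidableEq ι] {S T R : Matrix ι ι ℝ} {α : ℝ}

/-- The chain censored on the level of one packet. -/
noncomputable def censored (S T R : Matrix ι ι ℝ) (α : ℝ) : Matrix ι ι ℝ :=
  (1 - α) • (S + T + R * S) + α • S

lemma one_sub_mul_censored
    (hR : R = α • T + R * ((1 - α) • T + α • S) + R ^ 2 * ((1 - α) • S)) :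
    (1 - R) * censored S T R α = S + T - R := by
  have h : (1 - R) * censored S T R α = S + T -
      (α • T + R * ((1 - α) • T + α • S) + R ^ 2 * ((1 - α) • S)) := by
    simp only [censored, sub_mul, one_mul, mul_add, mul_smul_comm, sq, ← mul_assoc]
    module
  rw [h, ← hR]

variable (hA : (S + T) *ᵥ 1 = 1) (hunit : IsUnit (1 - R))
  (hR : R = α • T + R * ((1 - α) • T + α • S) + R ^ 2 * ((1 - α) • S))
include hA hunit hR

lemma censored_mulVec_one : censored S T R α *ᵥ 1 = 1 := by
  refine Matrix.mulVec_injective_of_isUnit hunit ?_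
  rw [Matrix.mulVec_mulVec, one_sub_mul_censored hR, Matrix.sub_mulVec, hA, Matrix.sub_mulVec,
    Matrix.one_mulVec]

variable [Nonempty ι] (hM : IsUnit ((S + T)ᵀ - 1 + Matrix.vecMulVec 1 1))
include hM

lemma vecMul_censored_eq_iff (v : ι → ℝ) : v ᵥ* censored S T R α = v ↔
    ∃ c : ℝ, c • ((((S + T)ᵀ - 1 + Matrix.vecMulVec 1 1)⁻¹ *ᵥ 1) ᵥ* (1 - R)) = v := by
  have hdet := (Matrix.isUnit_iff_isUnit_det _).1 hunit
  constructor
  · intro hv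
    have hvη : (v ᵥ* (1 - R)⁻¹) ᵥ* (1 - R) = v := by
      rw [Matrix.vecMul_vecMul, Matrix.nonsing_inv_mul _ hdet, Matrix.vecMul_one]
    set η := v ᵥ* (1 - R)⁻¹
    have hη : η ᵥ* (S + T) = η := by
      have h : η ᵥ* (S + T - R) = η ᵥ* (1 - R) := by
        rw [← one_sub_mul_censored hR, ← Matrix.vecMul_vecMul, hvη, hv]
      rw [Matrix.vecMul_sub, Matrix.vecMul_sub, Matrix.vecMul_one] at h
      exact sub_left_injective h
    refine ⟨η ⬝ᵥ 1, ?_⟩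
    rw [← Matrix.smul_vecMul, ← eq_smul_stationary hA hM hη, hvη]
  · rintro ⟨c, rfl⟩
    rw [Matrix.smul_vecMul, Matrix.vecMul_vecMul, one_sub_mul_censored hR, Matrix.vecMul_sub,
      stationary_vecMul hA hM, Matrix.vecMul_sub, Matrix.vecMul_one]

omit hR in
lemma stationary_dotProduct_inv :
    ((((S + T)ᵀ - 1 + Matrix.vecMulVec 1 1)⁻¹ *ᵥ 1) ᵥ* (1 - R)) ⬝ᵥ ((1 - R)⁻¹ *ᵥ 1) = 1 := by
  rw [Matrix.dotProduct_mulVec, Matrix.vecMul_vecMul, Matrix.mul_nonsing_inv _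
    ((Matrix.isUnit_iff_isUnit_det _).1 hunit), Matrix.vecMul_one, stationary_sum_eq_one hA hM]

lemma stationary_vecMul_one_sub_nonneg (hα : 0 ≤ α) (hα1 : α ≤ 1) (hS : ∀ i j, 0 ≤ S i j)
    (hT : ∀ i j, 0 ≤ T i j) (hRn : ∀ i j, 0 ≤ R i j) (hinv : ∀ i j, 0 ≤ (1 - R)⁻¹ i j) (i : ι) :
    0 ≤ ((((S + T)ᵀ - 1 + Matrix.vecMulVec 1 1)⁻¹ *ᵥ 1) ᵥ* (1 - R)) i := by
  have h1 := stationary_dotProduct_inv hA hunit hM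
  have hiff := vecMul_censored_eq_iff hA hunit hR hM
  set v := (((S + T)ᵀ - 1 + Matrix.vecMulVec 1 1)⁻¹ *ᵥ 1) ᵥ* (1 - R)
  have hW : ∀ i j, 0 ≤ censored S T R α i j := by
    intro i j
    have := mul_nonneg_entry hRn hS i j
    simp only [censored, Matrix.add_apply, Matrix.smul_apply, smul_eq_mul]
    have := hS i j
    have := hT i j
    have : 0 ≤ 1 - α := by linarith
    positivity
  obtain ⟨c, hc⟩ := (hiff |v|).1
    (abs_vecMul_eq hW (censored_mulVec_one hA hunit hR) ((hiff v).2 ⟨1, one_smul _ _⟩))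
  have hc0 : 0 ≤ c := by
    have h : c = |v| ⬝ᵥ ((1 - R)⁻¹ *ᵥ 1) := by
      rw [← hc, smul_dotProduct, h1, smul_eq_mul, mul_one]
    rw [h]
    exact Finset.sum_nonneg fun i _ => mul_nonneg (abs_nonneg _)
      (mulVec_nonneg_entry hinv (fun _ => zero_le_one) i)
  have hi : c * v i = |v i| := congrFun hc i
  by_contra! hneg
  have := abs_pos.2 hneg.ne
  nlinarith

end Queue

/-! ### Sums over levels -/

section Sums

variable {κ ι : Type*} [Fintype κ] [Fintype ι]

lemma hasSum_levels {f : κ ⊕ (ℕ × ι) → ℝ} {a : ι → ℝ}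
    (h : ∀ x, HasSum (fun k => f (Sum.inr (k, x))) (a x)) :
    HasSum f (∑ b, f (Sum.inl b) + ∑ x, a x) := by
  classical
  refine HasSum.sum (hasSum_fintype _) ?_
  have hf : f ∘ Sum.inr = fun q : ℕ × ι =>
      ∑ x, if q.2 = x then f (Sum.inr (q.1, x)) else 0 := by
    ext q; simp
  rw [hf]
  refine hasSum_sum fun x _ => ?_
  have hinj : Function.Injective fun k : ℕ => (k, x) := fun k l hkl => congrArg Prod.fst hkl
  refine (hinj.hasSum_iff ?_).1 ?_
  · rintro ⟨k, y⟩ hy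
    exact if_neg fun h => hy ⟨k, by rw [← h]⟩
  · simpa [Function.comp_def] using h x

end Sums

end QBD

namespace RateAdaptation

open Filter Topology

/-! ### The blocks of the rate adaptation queue -/

variable {N : ℕ} {p : ℕ → ℝ} {α d u : ℝ}

lemma matT_nonneg (hp : ∀ n, 1 ≤ n → n ≤ N → 0 ≤ p n ∧ p n ≤ 1) (hd : 0 ≤ d ∧ d ≤ 1)
    (x y : Phase N) : 0 ≤ matT N p d x y := by
  have hx := hp (rate x) (by simp [rate]) x.1.isLt
  have h1 : 0 ≤ 1 - p (rate x) := sub_nonneg.2 hx.2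
  have h2 : 0 ≤ 1 - d := sub_nonneg.2 hd.2
  have h3 := hd.1
  have h4 := hx.1
  simp only [matT, Matrix.of_apply, blockF, blockD]
  split_ifs with h5 h6 h7 h8 h9 h10 <;> try positivity
  rw [h9, Nat.add_sub_cancel]
  positivity

lemma matS_nonneg (hp : ∀ n, 1 ≤ n → n ≤ N → 0 ≤ p n ∧ p n ≤ 1) (hu : 0 ≤ u ∧ u ≤ 1)
    (x y : Phase N) : 0 ≤ matS N p u x y := by
  have hx := (hp (rate x) (by simp [rate]) x.1.isLt).1
  have h2 : 0 ≤ 1 - u := sub_nonneg.2 hu.2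
  have h3 := hu.1
  simp only [matS, Matrix.of_apply, blockM, blockU]
  split_ifs with h4 h5 h6 h7 h8 <;> try positivity
  · rwa [← h5]
  · rw [← h7]; positivity

lemma matE_nonneg (hp : ∀ n, 1 ≤ n → n ≤ N → 0 ≤ p n ∧ p n ≤ 1) (hu : 0 ≤ u ∧ u ≤ 1)
    (x : Phase N) (b : Fin N) : 0 ≤ matE N p u x b := by
  have hx := (hp (rate x) (by simp [rate]) x.1.isLt).1
  have h2 : 0 ≤ 1 - u := sub_nonneg.2 hu.2
  have h3 := hu.1
  simp only [matE, Matrix.of_apply, blockM, blockU]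
  split_ifs with h4 h5 h6 h7 h8 <;> try positivity
  · rwa [← h5]
  · rw [← h7]; positivity

lemma matE_mul_matC : matE N p u * matC N = matS N p u := by
  ext x y
  have hC : ∀ b : Fin N, matC N b y = if b = y.1 then (if frag y = 1 then 1 else 0) else 0 := by
    intro b
    have hy : rate y = y.1.val + 1 := rfl
    simp only [matC, Matrix.of_apply, Fin.ext_iff, hy, ← ite_and]
    exact if_congr (by omega) rfl rfl
  rw [Matrix.mul_apply]
  simp only [hC, mul_ite, mul_one, mul_zero, Finset.sum_ite_eq', Finset.mem_univ, if_true]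
  have hy : y.1.val + 1 = rate y := rfl
  split_ifs with h
  · simp only [matE, matS, Matrix.of_apply, h, hy]
  · have hfr : frag y ≤ rate y := y.2.isLt
    have hf1 : 1 ≤ frag y := by simp [frag]
    simp only [matS, Matrix.of_apply, blockM, blockU, h, and_false, if_false]
    split_ifs with h4 h5
    · omega
    · rfl
    · rfl
    · rfl

lemma sum_phase (f : ℕ → ℕ → ℝ) : ∑ y : Phase N, f (rate y) (frag y) =
    ∑ m ∈ Finset.range N, ∑ j ∈ Finset.range (m + 1), f (m + 1) (j + 1) := by
  rw [Fintype.sum_sigma, ← Fin.sum_univ_eq_sum_range]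
  exact Finset.sum_congr rfl fun m _ => Fin.sum_univ_eq_sum_range (fun j => f (m + 1) (j + 1)) _

lemma sum_succ_eq (q f : ℕ) (c : ℝ) :
    ∑ j ∈ Finset.range q, (if j + 1 = f then c else 0) = if 1 ≤ f ∧ f ≤ q then c else 0 := by
  cases f with
  | zero => simp
  | succ f =>
    simp only [Nat.add_right_cancel_iff, Finset.sum_ite_eq', Finset.mem_range]
    exact if_congr (by omega) rfl rfl

lemma sum_rate_eq (q : ℕ) (h : ℕ → ℝ) :
    ∑ m ∈ Finset.range N, ∑ j ∈ Finset.range (m + 1), (if m + 1 = q then h (j + 1) else 0) =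
      if 1 ≤ q ∧ q ≤ N then ∑ j ∈ Finset.range q, h (j + 1) else 0 := by
  rw [← sum_succ_eq]
  refine Finset.sum_congr rfl fun m _ => ?_
  split_ifs with hm
  · rw [hm]
  · simp

lemma matS_add_matT_mulVec_one : (matS N p u + matT N p d) *ᵥ 1 = 1 := by
  ext x
  obtain ⟨n, hn⟩ : ∃ n, rate x = n + 1 := ⟨_, rfl⟩
  obtain ⟨i, hi⟩ : ∃ i, frag x = i + 1 := ⟨_, rfl⟩
  have hnN : n + 1 ≤ N := hn ▸ x.1.isLt
  have hin : i + 1 ≤ n + 1 := hi ▸ hn ▸ x.2.isLt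
  obtain ⟨a, ha⟩ : ∃ a, a = if i = 0 ∧ n + 1 < N then (1 - d) * (1 - p (n + 1))
    else 1 - p (n + 1) := ⟨_, rfl⟩
  obtain ⟨b, hb⟩ : ∃ b, b = if i = n then (if n = 0 then p 1 else (1 - u) * p (n + 1)) else 0 :=
    ⟨_, rfl⟩
  obtain ⟨φ, hφ⟩ : ∃ φ : ℕ → ℕ → ℝ, φ = fun r f =>
      (if r = n + 1 then ((if f = i + 1 then a else 0) + (if f = i + 2 then p (n + 1) else 0) +
        (if f = 1 then b else 0)) else 0) +
      (if r = n + 2 then (if f = 1 then (if i = 0 then d * (1 - p (n + 1)) else 0) else 0)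
        else 0) +
      (if r = n then (if f = 1 then (if i = n then u * p (n + 1) else 0) else 0) else 0) :=
    ⟨_, rfl⟩
  have hrow : ∀ y : Phase N, (matS N p u + matT N p d) x y = φ (rate y) (frag y) := by
    intro y
    have hfr : frag y ≤ rate y := y.2.isLt
    have hf1 : 1 ≤ frag y := by simp [frag]
    simp only [Matrix.add_apply, matS, matT, Matrix.of_apply, blockM, blockU, blockF, blockD, hn,
      hi, hφ]
    generalize rate y = r at *
    generalize frag y = f at *
    by_cases h1 : r = n + 1
    · grind
    by_cases h2 : r = n + 2
    · grind
    by_cases h3 : r = n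
    · grind
    grind
  simp only [Matrix.mulVec, dotProduct, Pi.one_apply, mul_one, hrow]
  rw [sum_phase, hφ]
  simp only [Finset.sum_add_distrib]
  rw [sum_rate_eq (n + 1) fun f => (if f = i + 1 then a else 0) +
      (if f = i + 2 then p (n + 1) else 0) + (if f = 1 then b else 0),
    sum_rate_eq (n + 2) fun f => if f = 1 then (if i = 0 then d * (1 - p (n + 1)) else 0) else 0,
    sum_rate_eq n fun f => if f = 1 then (if i = n then u * p (n + 1) else 0) else 0]
  simp only [Finset.sum_add_distrib, sum_succ_eq]
  grind

/-! ### The balance equations -/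

variable (N p α d u) in
/-- The balance equations in block form. -/
structure IsBalanced (π : State N → ℝ) : Prop where
  empty : idle π = (1 - α) • idle π + (1 - α) • (busy π 0 ᵥ* matE N p u)
  first : busy π 0 = α • (idle π ᵥ* matC N) +
    busy π 0 ᵥ* ((1 - α) • matT N p d + α • matS N p u) + busy π 1 ᵥ* ((1 - α) • matS N p u)
  succ : ∀ k, busy π (k + 1) = busy π k ᵥ* (α • matT N p d) +
    busy π (k + 1) ᵥ* ((1 - α) • matT N p d + α • matS N p u) +
    busy π (k + 2) ᵥ* ((1 - α) • matS N p u)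

lemma hasSum_inflow_idle (π : State N → ℝ) (b : Fin N) :
    HasSum (fun r => π r * transition N p α d u r (Sum.inl b))
      (((1 - α) • idle π + (1 - α) • (busy π 0 ᵥ* matE N p u)) b) := by
  have h := QBD.hasSum_levels (f := fun r => π r * transition N p α d u r (Sum.inl b))
    (a := fun x => busy π 0 x * ((1 - α) • matE N p u) x b) fun x => by
      have h := hasSum_single (f := fun k => π (Sum.inr (k, x)) *
        transition N p α d u (Sum.inr (k, x)) (Sum.inl b)) 0 fun k hk => by simp [transition, hk]
      simpa [transition, busy] using h
  convert h using 1
  simp [transition, idle, Matrix.vecMul, dotProduct, Matrix.one_apply, Finset.mul_sum,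
    mul_left_comm, mul_comm]

lemma hasSum_inflow_first (π : State N → ℝ) (y : Phase N) :
    HasSum (fun r => π r * transition N p α d u r (Sum.inr (0, y)))
      ((α • (idle π ᵥ* matC N) + busy π 0 ᵥ* ((1 - α) • matT N p d + α • matS N p u) +
        busy π 1 ᵥ* ((1 - α) • matS N p u)) y) := by
  have h := QBD.hasSum_levels (f := fun r => π r * transition N p α d u r (Sum.inr (0, y)))
    (a := fun x => busy π 0 x * ((1 - α) • matT N p d + α • matS N p u) x y +
      busy π 1 x * ((1 - α) • matS N p u) x y) fun x => by
      have h := hasSum_sum_of_ne_finset_zero (L := .unconditional ℕ) (f := fun k => π (Sum.inr (k, x)) *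
        transition N p α d u (Sum.inr (k, x)) (Sum.inr (0, y))) (s := Finset.range 2)
        fun k hk => by
          rw [Finset.mem_range] at hk
          simp only [transition]
          rw [if_neg (by omega), if_neg (by omega), if_neg (by omega), mul_zero]
      simpa [transition, busy, Finset.sum_range_succ] using h
  convert h using 1
  rw [Finset.sum_add_distrib, ← add_assoc]
  simp [transition, idle, Matrix.vecMul, dotProduct, Finset.mul_sum, mul_left_comm]

lemma hasSum_inflow_succ (π : State N → ℝ) (l : ℕ) (y : Phase N) :
    HasSum (fun r => π r * transition N p α d u r (Sum.inr (l + 1, y)))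
      ((busy π l ᵥ* (α • matT N p d) +
        busy π (l + 1) ᵥ* ((1 - α) • matT N p d + α • matS N p u) +
        busy π (l + 2) ᵥ* ((1 - α) • matS N p u)) y) := by
  have h := QBD.hasSum_levels (f := fun r => π r * transition N p α d u r (Sum.inr (l + 1, y)))
    (a := fun x => busy π l x * (α • matT N p d) x y +
      busy π (l + 1) x * ((1 - α) • matT N p d + α • matS N p u) x y +
      busy π (l + 2) x * ((1 - α) • matS N p u) x y) fun x => by
      have h := hasSum_sum_of_ne_finset_zero (L := .unconditional ℕ) (f := fun k => π (Sum.inr (k, x)) *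
        transition N p α d u (Sum.inr (k, x)) (Sum.inr (l + 1, y))) (s := {l, l + 1, l + 2})
        fun k hk => by
          simp only [Finset.mem_insert, Finset.mem_singleton] at hk
          simp only [transition]
          rw [if_neg (by omega), if_neg (by omega), if_neg (by omega), mul_zero]
      rw [Finset.sum_insert (by simp), Finset.sum_insert (by simp), Finset.sum_singleton,
        ← add_assoc] at h
      simpa [transition, busy] using h
  convert h using 1
  rw [Finset.sum_add_distrib, Finset.sum_add_distrib]
  simp [transition, Matrix.vecMul, dotProduct]

lemma isBalanced_iff (π : State N → ℝ) : IsBalanced N p α d u π ↔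
    ∀ s, HasSum (fun r => π r * transition N p α d u r s) (π s) := by
  constructor
  · rintro ⟨h0, h1, h2⟩ (b | ⟨_ | k, y⟩)
    · have h := hasSum_inflow_idle (p := p) (α := α) (d := d) (u := u) π b
      rwa [← h0] at h
    · have h := hasSum_inflow_first (p := p) (α := α) (d := d) (u := u) π y
      rwa [← h1] at h
    · have h := hasSum_inflow_succ (p := p) (α := α) (d := d) (u := u) π k y
      rwa [← h2] at h
  · intro h
    refine ⟨funext fun b => ?_, funext fun y => ?_, fun k => funext fun y => ?_⟩
    · exact (h (Sum.inl b)).unique (hasSum_inflow_idle π b)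
    · exact (h (Sum.inr (0, y))).unique (hasSum_inflow_first π y)
    · exact (h (Sum.inr (k + 1, y))).unique (hasSum_inflow_succ π k y)

end RateAdaptation

namespace RateAdaptation

open Filter Topology

variable {N : ℕ} {p : ℕ → ℝ} {α d u : ℝ}

/-! ### Consequences of stability -/

lemma Stable.isUnit (h : Stable N p α d u) :
    IsUnit ((matS N p u + matT N p d)ᵀ - 1 + Matrix.vecMulVec 1 1) := by
  rw [Matrix.isUnit_iff_isUnit_det]
  by_contra hM
  rw [Stable, phaseVec, Matrix.nonsing_inv_apply_not_isUnit _ hM] at h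
  simp at h

lemma Stable.nonempty (h : Stable N p α d u) : Nonempty (Phase N) := by
  by_contra hN
  rw [not_nonempty_iff] at hN
  simp [Stable, dotProduct] at h

lemma isNonnegSolution_iff {R : Matrix (Phase N) (Phase N) ℝ} : IsNonnegSolution N p α d u R ↔
    (∀ x y, 0 ≤ R x y) ∧ R = α • matT N p d + R * ((1 - α) • matT N p d + α • matS N p u)
      + R ^ 2 * ((1 - α) • matS N p u) := by
  rw [IsNonnegSolution, mul_smul_comm, add_comm (α • matS N p u)]

lemma matQ_mulVec (R : Matrix (Phase N) (Phase N) ℝ) (v : Phase N → ℝ) :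
    matQ N p α d u R *ᵥ v = v ᵥ* QBD.censored (matS N p u) (matT N p d) R α - v := by
  rw [matQ, Matrix.sub_mulVec, Matrix.mulVec_transpose, Matrix.one_mulVec, matE_mul_matC]
  rfl

/-- The vector `Π (1 - R)`, proportional to the stationary probabilities of one packet. -/
noncomputable def baseVec (N : ℕ) (p : ℕ → ℝ) (d u : ℝ) (R : Matrix (Phase N) (Phase N) ℝ) :
    Phase N → ℝ :=
  phaseVec N p d u ᵥ* (1 - R)

lemma mem_ker_matQ_iff (h : Stable N p α d u) {R : Matrix (Phase N) (Phase N) ℝ}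
    (hR : IsNonnegSolution N p α d u R) (hunit : IsUnit (1 - R)) (v : Phase N → ℝ) :
    matQ N p α d u R *ᵥ v = 0 ↔ ∃ c : ℝ, c • baseVec N p d u R = v := by
  have := h.nonempty
  rw [matQ_mulVec, sub_eq_zero, QBD.vecMul_censored_eq_iff matS_add_matT_mulVec_one hunit
    (isNonnegSolution_iff.1 hR).2 h.isUnit]
  rfl

lemma ker_matQ (h : Stable N p α d u) {R : Matrix (Phase N) (Phase N) ℝ}
    (hR : IsNonnegSolution N p α d u R) (hunit : IsUnit (1 - R)) :
    LinearMap.ker (matQ N p α d u R).mulVecLin = Submodule.span ℝ {baseVec N p d u R} := by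
  ext v
  rw [LinearMap.mem_ker, Matrix.mulVecLin_apply, mem_ker_matQ_iff h hR hunit,
    Submodule.mem_span_singleton]

/-- The matrix-geometric vector with first busy level `v`. -/
noncomputable def geometric (N : ℕ) (p : ℕ → ℝ) (α u : ℝ) (R : Matrix (Phase N) (Phase N) ℝ)
    (v : Phase N → ℝ) : State N → ℝ
  | Sum.inl a => (((1 - α) / α) • (v ᵥ* matE N p u)) a
  | Sum.inr (k, x) => (v ᵥ* R ^ k) x

lemma eq_geometric_iff {R : Matrix (Phase N) (Phase N) ℝ} {π : State N → ℝ} :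
    π = geometric N p α u R (busy π 0) ↔
      idle π = ((1 - α) / α) • (busy π 0 ᵥ* matE N p u) ∧
        ∀ k, busy π k = busy π 0 ᵥ* R ^ k := by
  constructor
  · intro h
    exact ⟨funext fun a => congrFun h (Sum.inl a),
      fun k => funext fun x => congrFun h (Sum.inr (k, x))⟩
  · rintro ⟨h0, h1⟩
    funext s
    rcases s with a | ⟨k, x⟩
    · exact congrFun h0 a
    · exact congrFun (h1 k) x

lemma busy_geometric_zero (R : Matrix (Phase N) (Phase N) ℝ) (v : Phase N → ℝ) :
    busy (geometric N p α u R v) 0 = v := by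
  ext x
  simp [busy, geometric]

lemma geometric_hasSum {R : Matrix (Phase N) (Phase N) ℝ}
    (hsum : HasSum (fun k : ℕ => R ^ k) (1 - R)⁻¹) (v : Phase N → ℝ) :
    HasSum (geometric N p α u R v)
      (idle (geometric N p α u R v) ⬝ᵥ 1 + v ⬝ᵥ ((1 - R)⁻¹ *ᵥ 1)) := by
  rw [Matrix.dotProduct_mulVec, dotProduct_one, dotProduct_one]
  refine QBD.hasSum_levels fun x => hasSum_sum fun y _ => ?_
  exact (Pi.hasSum.1 (Pi.hasSum.1 hsum y) x).mul_left (v y)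

lemma geometric_isBalanced (hα : α ≠ 0) {R : Matrix (Phase N) (Phase N) ℝ}
    (hR : IsNonnegSolution N p α d u R) {v : Phase N → ℝ}
    (hv : matQ N p α d u R *ᵥ v = 0) : IsBalanced N p α d u (geometric N p α u R v) := by
  have hb : ∀ k, busy (geometric N p α u R v) k = v ᵥ* R ^ k := fun k => rfl
  have hi : idle (geometric N p α u R v) = ((1 - α) / α) • (v ᵥ* matE N p u) := rfl
  have hRe := (isNonnegSolution_iff.1 hR).2
  refine ⟨?_, ?_, fun k => ?_⟩
  · rw [hi, hb, pow_zero, Matrix.vecMul_one, smul_smul, ← add_smul]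
    congr 1
    field_simp
    ring
  · rw [matQ_mulVec, sub_eq_zero] at hv
    rw [hi, hb, hb, pow_zero, Matrix.vecMul_one, pow_one, Matrix.smul_vecMul,
      Matrix.vecMul_vecMul, matE_mul_matC, smul_smul, mul_div_cancel₀ _ hα]
    conv_lhs => rw [← hv]
    simp only [QBD.censored, Matrix.vecMul_add, Matrix.vecMul_smul, Matrix.vecMul_vecMul]
    module
  · rw [hb, hb, hb, Matrix.vecMul_vecMul, Matrix.vecMul_vecMul, Matrix.vecMul_vecMul,
      ← Matrix.vecMul_add, ← Matrix.vecMul_add]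
    have h := congrArg (R ^ k * ·) hRe
    simp only [mul_add, ← mul_assoc] at h
    rw [← pow_succ, ← pow_add] at h
    simp only [mul_add]
    rw [← h]

lemma IsBalanced.idle_eq (hα : α ≠ 0) {π : State N → ℝ} (h : IsBalanced N p α d u π) :
    idle π = ((1 - α) / α) • (busy π 0 ᵥ* matE N p u) := by
  have h0 := h.empty
  have h1 : α • idle π = (1 - α) • (busy π 0 ᵥ* matE N p u) := by
    rw [sub_smul, one_smul] at h0
    linear_combination (exp := 1) h0
  rw [div_eq_inv_mul, ← smul_smul, ← h1, smul_smul, inv_mul_cancel₀ hα, one_smul]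

lemma IsBalanced.matQ_mulVec_busy (hα : α ≠ 0) {R : Matrix (Phase N) (Phase N) ℝ}
    {π : State N → ℝ} (h : IsBalanced N p α d u π) (h1 : busy π 1 = busy π 0 ᵥ* R) :
    matQ N p α d u R *ᵥ busy π 0 = 0 := by
  rw [matQ_mulVec, sub_eq_zero]
  conv_rhs => rw [h.first, h.idle_eq hα, h1, Matrix.smul_vecMul,
      Matrix.vecMul_vecMul, matE_mul_matC, smul_smul, mul_div_cancel₀ _ hα]
  simp only [QBD.censored, Matrix.vecMul_add, Matrix.vecMul_smul, Matrix.vecMul_vecMul]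
  module

lemma summable_busy {π : State N → ℝ} (h : Summable π) : Summable (busy π) :=
  Pi.summable.2 fun x => h.comp_injective (i := fun k : ℕ => (Sum.inr (k, x) : State N))
    fun _ _ hkl => congrArg Prod.fst (Sum.inr_injective hkl)

/-- For a stable queue, the stationary distributions are the normalized matrix-geometric vectors
over the kernel of `Q`. -/
theorem isStationary_iff (hα0 : 0 < α) (hα1 : α < 1)
    (hp : ∀ n, 1 ≤ n → n ≤ N → 0 ≤ p n ∧ p n ≤ 1)
    (hd : 0 ≤ d ∧ d ≤ 1) (hu : 0 ≤ u ∧ u ≤ 1) (h : Stable N p α d u) :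
    ∃ R : Matrix (Phase N) (Phase N) ℝ, IsRateMatrix N p α d u R ∧ IsUnit (1 - R) ∧
      (∀ x, 0 ≤ baseVec N p d u R x) ∧
      baseVec N p d u R ⬝ᵥ ((1 - R)⁻¹ *ᵥ 1) = 1 ∧
      ∀ π : State N → ℝ, IsStationary N p α d u π ↔
        ∃ c : ℝ, π = geometric N p α u R (c • baseVec N p d u R) ∧
          idle π ⬝ᵥ 1 + busy π 0 ⬝ᵥ ((1 - R)⁻¹ *ᵥ 1) = 1 := by
  have hne := h.nonempty
  have hM := h.isUnit
  have hS := matS_nonneg (u := u) hp hu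
  have hT := matT_nonneg (d := d) hp hd
  have hE := matE_nonneg (u := u) hp hu
  have hA := matS_add_matT_mulVec_one (N := N) (p := p) (d := d) (u := u)
  have hα : 0 ≤ 1 - α := by linarith
  set A₀ := α • matT N p d with hA₀
  set A₁ := (1 - α) • matT N p d + α • matS N p u with hA₁
  set A₂ := (1 - α) • matS N p u with hA₂
  have hsumA : A₀ + A₁ + A₂ = matS N p u + matT N p d := by rw [hA₀, hA₁, hA₂]; module
  have h₀ : ∀ x y, 0 ≤ A₀ x y := fun x y => mul_nonneg hα0.le (hT x y)
  have h₁ : ∀ x y, 0 ≤ A₁ x y := fun x y =>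
    add_nonneg (mul_nonneg hα (hT x y)) (mul_nonneg hα0.le (hS x y))
  have h₂ : ∀ x y, 0 ≤ A₂ x y := fun x y => mul_nonneg hα (hS x y)
  obtain ⟨g, hg, hdrift⟩ := QBD.exists_poisson hA hM (A₂ *ᵥ 1 - A₀ *ᵥ 1)
  set δ := phaseVec N p d u ⬝ᵥ (A₂ *ᵥ 1 - A₀ *ᵥ 1) with hδ_def
  have hδ : 0 < δ := by
    rw [hδ_def, hA₀, hA₂, dotProduct_sub, Matrix.smul_mulVec, Matrix.smul_mulVec,
      dotProduct_smul, dotProduct_smul]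
    exact sub_pos.2 h
  change _ = A₂ *ᵥ 1 - A₀ *ᵥ 1 - δ • 1 at hdrift
  rw [← hsumA] at hdrift
  have hA' : (A₀ + A₁ + A₂) *ᵥ 1 = 1 := by rw [hsumA, hA]
  obtain ⟨R, hlim, hRn, hR, hmin, hunit, hsum⟩ :=
    QBD.exists_rate_matrix h₀ h₁ h₂ hδ hg hdrift hA'
  have hsol : IsNonnegSolution N p α d u R := isNonnegSolution_iff.2 ⟨hRn, hR⟩
  have hinv : ∀ x y, 0 ≤ (1 - R)⁻¹ x y := fun x y =>
    (Pi.hasSum.1 (Pi.hasSum.1 hsum x) y).nonneg fun k => QBD.pow_nonneg_entry hRn k x y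
  have hbase : ∀ x, 0 ≤ baseVec N p d u R x :=
    QBD.stationary_vecMul_one_sub_nonneg hA hunit hR hM hα0.le hα1.le hS hT hRn hinv
  have hbase1 : baseVec N p d u R ⬝ᵥ ((1 - R)⁻¹ *ᵥ 1) = 1 :=
    QBD.stationary_dotProduct_inv hA hunit hM
  have hge : ∀ c : ℝ, 0 ≤ c → ∀ s, 0 ≤ geometric N p α u R (c • baseVec N p d u R) s := by
    intro c hc
    have hcb : ∀ x, 0 ≤ (c • baseVec N p d u R) x := fun x => mul_nonneg hc (hbase x)
    rintro (a | ⟨k, x⟩)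
    · exact mul_nonneg (div_nonneg hα hα0.le) (QBD.vecMul_nonneg_entry hcb hE a)
    · exact QBD.vecMul_nonneg_entry hcb (QBD.pow_nonneg_entry hRn k) x
  refine ⟨R, ⟨hsol, fun X hX => ?_⟩, hunit, hbase, hbase1, fun π => ⟨fun hπ => ?_, ?_⟩⟩
  · obtain ⟨hX0, hX1⟩ := isNonnegSolution_iff.1 hX
    exact hmin X hX0 hX1
  · have hbal := (isBalanced_iff π).2 hπ.balance
    have hgeo : ∀ k, busy π k = busy π 0 ᵥ* R ^ k :=
      QBD.eq_vecMul_rate_pow h₀ h₁ h₂ hδ hdrift hA' hlim hR hsum.summable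
        (fun k x => hπ.nonneg (Sum.inr (k, x))) (summable_busy hπ.hasSum_one.summable) hbal.succ
    have hπg := eq_geometric_iff.2 ⟨hbal.idle_eq hα0.ne', hgeo⟩
    have hker := hbal.matQ_mulVec_busy hα0.ne' (by simpa using hgeo 1)
    obtain ⟨c, hc⟩ := (mem_ker_matQ_iff h hsol hunit _).1 hker
    refine ⟨c, hc ▸ hπg, ?_⟩
    have hs := geometric_hasSum (p := p) (α := α) (u := u) hsum (busy π 0)
    rw [← hπg] at hs
    exact hs.unique hπ.hasSum_one
  · rintro ⟨c, hπ, hnorm⟩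
    have hb : busy π 0 = c • baseVec N p d u R := by rw [hπ, busy_geometric_zero]
    have hc : 0 ≤ c := by
      by_contra! hneg
      have hn : ∀ a, idle π a ≤ 0 := by
        intro a
        have h1 := hge (-c) (by linarith) (Sum.inl a)
        have h2 : idle π a = -geometric N p α u R (-c • baseVec N p d u R) (Sum.inl a) := by
          rw [hπ]
          simp [idle, geometric, Matrix.neg_vecMul]
        rw [h2]
        linarith
      have h3 : idle π ⬝ᵥ 1 ≤ 0 := by
        rw [dotProduct_one]; exact Finset.sum_nonpos fun a _ => hn a
      rw [hb, smul_dotProduct, hbase1, smul_eq_mul, mul_one] at hnorm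
      linarith
    refine ⟨fun s => ?_, ?_, ?_⟩
    · rw [hπ]; exact hge c hc s
    · have hs := geometric_hasSum (p := p) (α := α) (u := u) hsum (c • baseVec N p d u R)
      rwa [← hπ, ← hb, hnorm] at hs
    · rw [← isBalanced_iff, hπ]
      exact geometric_isBalanced hα0.ne' hsol ((mem_ker_matQ_iff h hsol hunit _).2 ⟨c, rfl⟩)

end RateAdaptation

theorem theorem2 (N : ℕ) (p : ℕ → ℝ) (α d u : ℝ)
    (hα0 : 0 < α) (hα1 : α < 1)
    (hp : ∀ n, 1 ≤ n → n ≤ N → 0 ≤ p n ∧ p n ≤ 1)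
    (hd : 0 ≤ d ∧ d ≤ 1) (hu : 0 ≤ u ∧ u ≤ 1)
    (hstable : RateAdaptation.Stable N p α d u) :
    ∃ R : Matrix (RateAdaptation.Phase N) (RateAdaptation.Phase N) ℝ,
      RateAdaptation.IsRateMatrix N p α d u R ∧
      IsUnit (1 - R) ∧
      (∃! π : RateAdaptation.State N → ℝ, RateAdaptation.IsStationary N p α d u π) ∧
      ∀ π : RateAdaptation.State N → ℝ,
        RateAdaptation.IsStationary N p α d u π ↔
          (LinearMap.ker (RateAdaptation.matQ N p α d u R).mulVecLin =
              Submodule.span ℝ {RateAdaptation.busy π 0} ∧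
            RateAdaptation.idle π =
              ((1 - α) / α) • (RateAdaptation.busy π 0 ᵥ* RateAdaptation.matE N p u) ∧
            (∀ k : ℕ, RateAdaptation.busy π k = RateAdaptation.busy π 0 ᵥ* R ^ k) ∧
            RateAdaptation.idle π ⬝ᵥ 1 +
              RateAdaptation.busy π 0 ⬝ᵥ ((1 - R)⁻¹ *ᵥ 1) = 1) := by
  open RateAdaptation in
  obtain ⟨R, hrate, hunit, hbase, hbase1, hiff⟩ := isStationary_iff hα0 hα1 hp hd hu hstable
  set v := baseVec N p d u R with hv
  have hker := ker_matQ hstable hrate.1 hunit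
  have hcoef : ∀ c : ℝ, idle (geometric N p α u R (c • v)) ⬝ᵥ 1 +
      busy (geometric N p α u R (c • v)) 0 ⬝ᵥ ((1 - R)⁻¹ *ᵥ 1) =
      c * (idle (geometric N p α u R v) ⬝ᵥ 1 + 1) := by
    intro c
    have hi : idle (geometric N p α u R (c • v)) = c • idle (geometric N p α u R v) := by
      ext a
      simp [idle, geometric, Matrix.smul_vecMul]
      ring
    rw [busy_geometric_zero, hi, smul_dotProduct, smul_dotProduct, hbase1, smul_eq_mul,
      smul_eq_mul]
    ring
  have hpos : 0 < idle (geometric N p α u R v) ⬝ᵥ 1 + 1 := by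
    rw [dotProduct_one]
    refine add_pos_of_nonneg_of_pos (Finset.sum_nonneg fun a _ => ?_) one_pos
    exact mul_nonneg (div_nonneg (by linarith) hα0.le)
      (QBD.vecMul_nonneg_entry hbase (matE_nonneg hp hu) a)
  refine ⟨R, hrate, hunit, ?_, fun π => (hiff π).trans ⟨?_, ?_⟩⟩
  · refine ⟨geometric N p α u R ((idle (geometric N p α u R v) ⬝ᵥ 1 + 1)⁻¹ • v), ?_, ?_⟩
    · exact (hiff _).2 ⟨_, rfl, by rw [hcoef, inv_mul_cancel₀ hpos.ne']⟩
    · intro π hπ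
      obtain ⟨c, rfl, hc⟩ := (hiff π).1 hπ
      rw [hcoef] at hc
      rw [eq_inv_of_mul_eq_one_left hc]
  · rintro ⟨c, rfl, hc⟩
    refine ⟨?_, (eq_geometric_iff.1 (by rw [busy_geometric_zero])).1,
      (eq_geometric_iff.1 (by rw [busy_geometric_zero])).2, hc⟩
    rw [hcoef] at hc
    have hc0 : c ≠ 0 := left_ne_zero_of_mul_eq_one hc
    rw [hker, busy_geometric_zero, Submodule.span_singleton_smul_eq (IsUnit.mk0 c hc0)]
  · rintro ⟨hspan, hidle, hbusy, hnorm⟩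
    have hmem : busy π 0 ∈ Submodule.span ℝ {v} := by
      rw [hv, ← hker, hspan]
      exact Submodule.mem_span_singleton_self _
    obtain ⟨c, hc⟩ := Submodule.mem_span_singleton.1 hmem
    exact ⟨c, by rw [hc]; exact eq_geometric_iff.2 ⟨hidle, hbusy⟩, hnorm⟩
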